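/- Super Six is a game for two players with a fair die, a lid with six holes and a number of sticks. Holes 1 to 5 hold one stick each; a stick put into hole 6 falls into the box and is out of play. The player whose turn it is rolls the die. If the hole of the number rolled is occupied, the player takes that stick in hand and the turn passes to the opponent. Otherwise the player puts a stick from their hand into that hole; a player who thereby runs out of sticks wins; if not, the player chooses either to continue (roll again) or to stop (pass the turn), except that with an empty lid the player must continue. The situation $(j/k/l)$ means that $j$ sticks are on the lid, $k$ are in the hand of the player whose turn it is and $l$ in the hand of the opponent; $j+k+l$ is the number of sticks in play. A strategy assigns to each situation $(j/k/l)$ with $1\le j\le 5$, $k,l\ge 1$, reached by placing a stick, the choice to continue or to stop. A strategy $S$ is optimal with $i$ sticks in play if, from every situation with $i$ sticks in play and $k,l\ge1$, and for either player, using $S$ maximizes that player's winning probability among all strategies when the opponent uses $S$. Let $8\le i\le 12$. Let $\hat S$ be the strategy that continues when $1$, $2$ or $3$ sticks are on the lid and stops when $4$ or $5$ sticks are on the lid, except that it continues at $(4/1/1)$ (a situation with only $6$ sticks in play). Then: 1. $\hat S$ is optimal with $i$ sticks in play. 2. Every strategy that is optimal with $i$ sticks in play continues at every $(j/k/l)$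 with $j+k+l=i$, $k,l\ge1$ and $j\in\{1,2,3\}$, and stops at every $(j/k/l)$ with $j+k+l=i$, $k,l\ge1$ and $j\in\{4,5\}$. 3. For every $(j/k/l)$ with $j+k+l=i$, $1\le j\le5$, $k,l\ge1$: if both players use $\hat S$ with the choice at $(j/k/l)$ reversed, the winning probability at $(j-1/k+1/l)$ of the player about to roll is strictly smaller than if both use $\hat S$. -/

import Mathlib

noncomputable section

namespace SuperSix

/-- After successfully placing a stick, a player may pass the die to the opponent or continue to roll it. -/
inductive Choice
  | passDie
  | rollAgain

inductive Player
  | one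
  | two

def Player.other : Player → Player
  | .one => .two
  | .two => .one

/-- A situation `(j, k, l)`: `j` sticks on the lid, `k` sticks in the hand of the player whose
turn it is, `l` sticks in the hand of the opponent. -/
abbrev Situation := ℕ × ℕ × ℕ

/-- A strategy prescribes the choice to be made when a stick has just been placed and the
situation is now `(j, k, l)`. Its values at `j = 0` are never consulted, since a player always
continues when the lid is empty. -/
abbrev Strategy := Situation → Choice

/-- The number on the die: `some h` is one of the numbers of the five shallow holes, `none` is
the six, whose hole lets the stick fall into the box. -/
abbrev Face := Option (Fin 5)

/-- `toRoll p lid k l`: player `p` is about to roll the die, `lid` is the set of occupied holes,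
`p` has `k` sticks in hand, and the opponent has `l`. `won p`: player `p` has won. -/
inductive Position
  | toRoll (p : Player) (lid : Finset (Fin 5)) (k l : ℕ)
  | won (p : Player)

open Classical in
/-- Player `p` has just placed a stick; `lid`, `k` and `l` describe the outcome of this. -/
def afterPlacing (σ : Player → Strategy) (p : Player) (lid : Finset (Fin 5)) (k l : ℕ) :
    Position :=
  if k = 0 then .won p
  else if lid = ∅ ∨ σ p (lid.card, k, l) = .rollAgain then .toRoll p lid k l
  else .toRoll p.other lid l k

/-- The effect of one roll of the die, where player `p` uses the strategy `σ p`. -/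
def next (σ : Player → Strategy) : Position → Face → Position
  | .won p, _ => .won p
  | .toRoll p lid k l, none => afterPlacing σ p lid (k - 1) l
  | .toRoll p lid k l, some h =>
      if h ∈ lid then .toRoll p.other (lid.erase h) l (k + 1)
      else afterPlacing σ p (insert h lid) (k - 1) l

/-- The distribution of the position after `n` independent rolls of a fair die. -/
def play (σ : Player → Strategy) : ℕ → Position → PMF Position
  | 0, x => PMF.pure x
  | n + 1, x => (PMF.uniformOfFintype Face).bind fun r => play σ n (next σ x r)

/-- The probability that the player who is about to roll wins, when this player uses `S` and has
`k` sticks in hand, the opponent uses `T` and has `l` sticks in hand, and the holes in `lid` are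
occupied. A won position stays won, so the supremum is the probability that the player wins
after finitely many rolls. -/
def winProb (S T : Strategy) (lid : Finset (Fin 5)) (k l : ℕ) : ENNReal :=
  ⨆ n, play (fun p => match p with | .one => S | .two => T) n (.toRoll .one lid k l) (.won .one)

/-- `S` is optimal with `i` sticks in play: from every situation with `i` sticks, whoever is about
to roll, no player can gain by using another strategy when the opponent uses `S`. -/
def IsOptimal (i : ℕ) (S : Strategy) : Prop :=
  ∀ (lid : Finset (Fin 5)) (k l : ℕ), 1 ≤ k → 1 ≤ l → lid.card + k + l = i → ∀ T : Strategy,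
    winProb T S lid k l ≤ winProb S S lid k l ∧ winProb S S lid k l ≤ winProb S T lid k l

/-- The strategy that continues with one, two or three sticks on the lid and stops with four or
five, except that it continues at `(4, 1, 1)`, a situation with only six sticks in play. -/
def bestStrategy : Strategy := fun A =>
  if A.1 ≤ 3 ∨ A = (4, 1, 1) then .rollAgain else .passDie

end SuperSix

end

noncomputable section

namespace SuperSix

/-! The probability that player one wins is harmonic for the one-roll averaging operator `rollMean`.
Since a six removes a stick from play for good, a maximum principle holds: a bounded-stick
subharmonic function that is nonpositive once the game is over is nonpositive
(`nonpos_of_le_rollMean`). It yields uniqueness, comparison of strategies and error bounds.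

Let v(j/k/l) be the value for the player about to roll when both use `bestStrategy`. Continuing
after a placement is worth v(j/k/l), stopping 1 - v(j/l/k), so the sign of v(j/k/l) + v(j/l/k) - 1
decides. An integer table solves the equations for v up to a small residual, the maximum principle
turns this into an error bound for v, and kernel evaluation checks that every sign is as claimed
with a margin exceeding the error (`value_gap`).

Hence every deviating choice loses strictly in one roll, and comparison gives optimality
(`value_le_value_best`, `value_best_le_value`). Uniqueness follows because equilibria of a zero-sum
game are interchangeable. When both players change the same choice, the opponent errs too; there the
antisymmetry of the change in value under exchange of players is what makes the maximum principle
apply (`value_update_lt`). -/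

/-- The mean of `f` over the six positions that one roll of the die can produce from `x`. -/
def rollMean (σ : Player → Strategy) (f : Position → ℝ) (x : Position) : ℝ :=
  (∑ r : Face, f (next σ x r)) / 6

/-- The probability that player one eventually wins from `x`. -/
def value (σ : Player → Strategy) (x : Position) : ℝ :=
  (⨆ n, play σ n x (.won .one)).toReal

/-- The number of sticks in play; zero once the game is over. -/
def sticks : Position → ℕ
  | .toRoll _ lid k l => lid.card + k + l
  | .won _ => 0

/-- The game is over, or both players hold a stick and at most `N` sticks are in play. -/
def Legal (N : ℕ) : Position → Prop
  | .toRoll _ lid k l => 1 ≤ k ∧ 1 ≤ l ∧ lid.card + k + l ≤ N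
  | .won _ => True

/-! ### Harmonicity of the winning probability -/

lemma play_succ_apply (σ : Player → Strategy) (n : ℕ) (x y : Position) :
    play σ (n + 1) x y = ∑ r : Face, 6⁻¹ * play σ n (next σ x r) y := by
  simp [play, PMF.bind_apply, tsum_fintype, -Fintype.sum_option]

lemma play_won (σ : Player → Strategy) (n : ℕ) (p : Player) :
    play σ n (.won p) = PMF.pure (.won p) := by
  induction n with
  | zero => rfl
  | succ n ih => simp [play, next, ih]

lemma monotone_play (σ : Player → Strategy) (p : Player) (x : Position) :
    Monotone fun n => play σ n x (.won p) := by
  refine monotone_nat_of_le_succ fun n => ?_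
  induction n generalizing x with
  | zero =>
    by_cases hx : x = .won p
    · subst hx; rw [play_won, play_won]
    · simp [play, PMF.pure_apply, Ne.symm hx]
  | succ n ih =>
    rw [play_succ_apply, play_succ_apply]
    gcongr
    exact ih _

/-- Condition on the first roll. A won position is absorbing, so the probabilities increase with the
number of rolls and the supremum commutes with the finite sum. -/
lemma iSup_play_eq (σ : Player → Strategy) (p : Player) (x : Position) :
    ⨆ n, play σ n x (.won p) = ∑ r : Face, 6⁻¹ * ⨆ n, play σ n (next σ x r) (.won p) := by
  simp_rw [ENNReal.mul_iSup]
  rw [ENNReal.finsetSum_iSup_of_monotone]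
  · rw [← (monotone_play σ p x).iSup_nat_add 1]
    simp_rw [play_succ_apply]
  · intro r m n h
    dsimp only
    gcongr
    exact monotone_play σ p _ h

lemma iSup_play_ne_top (σ : Player → Strategy) (p : Player) (x : Position) :
    ⨆ n, play σ n x (.won p) ≠ ⊤ :=
  ne_top_of_le_ne_top ENNReal.one_ne_top (iSup_le fun _ => PMF.coe_le_one _ _)

lemma value_eq_rollMean (σ : Player → Strategy) (x : Position) :
    value σ x = rollMean σ (value σ) x := by
  unfold value rollMean
  rw [iSup_play_eq, ENNReal.toReal_sum, Finset.sum_div]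
  · refine Finset.sum_congr rfl fun r _ => ?_
    rw [ENNReal.toReal_mul, div_eq_inv_mul]
    simp
  · intro r _
    exact ENNReal.mul_ne_top (by simp) (iSup_play_ne_top _ _ _)

@[simp] lemma value_won_one (σ : Player → Strategy) : value σ (.won .one) = 1 := by
  simp [value, play_won]

@[simp] lemma value_won_two (σ : Player → Strategy) : value σ (.won .two) = 0 := by
  simp [value, play_won, PMF.pure_apply]

/-! ### The maximum principle -/

lemma next_legal {N : ℕ} (σ : Player → Strategy) {x : Position} (hx : Legal N x) (r : Face) :
    Legal N (next σ x r) := by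
  cases x with
  | won p => trivial
  | toRoll p lid k l =>
    obtain ⟨hk, hl, h⟩ := hx
    rcases r with _ | r
    · simp only [next, afterPlacing]
      split_ifs <;> simp only [Legal] <;> omega
    · simp only [next, afterPlacing]
      split_ifs with h1 h2 h3
      · have := Finset.card_erase_add_one h1
        simp only [Legal]; omega
      all_goals
        have := Finset.card_insert_of_notMem h1
        simp only [Legal]; try omega

lemma sticks_next_le (σ : Player → Strategy) (x : Position) (r : Face) :
    sticks (next σ x r) ≤ sticks x := by
  cases x with
  | won p => simp [next]
  | toRoll p lid k l =>
    rcases r with _ | r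
    · simp only [next, afterPlacing]
      split_ifs <;> simp only [sticks] <;> omega
    · simp only [next, afterPlacing]
      split_ifs with h1 h2 h3
      · have := Finset.card_erase_add_one h1
        simp only [sticks]; omega
      all_goals
        have := Finset.card_insert_of_notMem h1
        simp only [sticks]; omega

lemma sticks_next_six_lt (σ : Player → Strategy) (p : Player) (lid : Finset (Fin 5)) {k l : ℕ}
    (hk : 1 ≤ k) :
    sticks (next σ (.toRoll p lid k l) none) < sticks (.toRoll p lid k l) := by
  simp only [next, afterPlacing]
  split_ifs <;> simp only [sticks] <;> omega

lemma finite_legal (N : ℕ) : {x | Legal N x}.Finite := by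
  have hP : Finite Player :=
    Finite.of_injective (fun p => match p with | .one => true | .two => false)
      (by intro a b; cases a <;> cases b <;> simp)
  let f : Player × Finset (Fin 5) × Fin (N + 1) × Fin (N + 1) ⊕ Player → Position := fun y =>
    match y with
    | .inl (p, lid, k, l) => .toRoll p lid k l
    | .inr p => .won p
  refine (Set.finite_range f).subset ?_
  rintro (⟨p, lid, k, l⟩ | p) hx
  · simp only [Legal, Set.mem_ofPred_eq] at hx
    exact ⟨.inl (p, lid, ⟨k, by omega⟩, ⟨l, by omega⟩), rfl⟩
  · exact ⟨.inr p, rfl⟩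

/-- A subharmonic function that is nonpositive at the end of the game is nonpositive. -/
lemma nonpos_of_le_rollMean {N : ℕ} {σ : Player → Strategy} {f : Position → ℝ}
    (hwon : ∀ p, f (.won p) ≤ 0) (hf : ∀ x, Legal N x → f x ≤ rollMean σ f x)
    {x : Position} (hx : Legal N x) : f x ≤ 0 := by
  obtain ⟨m, hm, hmax⟩ := Set.exists_max_image _ f (finite_legal N) ⟨x, hx⟩
  refine (hmax x hx).trans ?_
  by_contra! hpos
  -- No legal position attains the maximum, by induction on the sticks in play: a six leads to fewer
  -- sticks, hence to a value below the maximum, and this pulls the mean strictly below it.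
  have key : ∀ n y, Legal N y → sticks y = n → f y ≠ f m := by
    intro n
    induction n using Nat.strong_induction_on with
    | _ n ih =>
      intro y hy hn hfy
      cases y with
      | won p => linarith [hwon p]
      | toRoll p lid k l =>
        have h6 := ih _ (hn ▸ sticks_next_six_lt σ p lid (l := l) hy.1) _ (next_legal σ hy none) rfl
        have hlt : ∑ r : Face, f (next σ (.toRoll p lid k l) r) < ∑ r : Face, f m :=
          Finset.sum_lt_sum (fun r _ => hmax _ (next_legal σ hy r))
            ⟨none, Finset.mem_univ _, lt_of_le_of_ne (hmax _ (next_legal σ hy none)) h6⟩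
        have := hf _ hy
        simp [rollMean, -Fintype.sum_option] at this hlt
        linarith
  exact key _ m hm rfl rfl

lemma rollMean_sub (σ : Player → Strategy) (f g : Position → ℝ) (x : Position) :
    rollMean σ (fun y => f y - g y) x = rollMean σ f x - rollMean σ g x := by
  simp only [rollMean, Finset.sum_sub_distrib, sub_div]

lemma rollMean_mono {σ τ : Player → Strategy} {f g : Position → ℝ} {x : Position}
    (h : ∀ r, f (next σ x r) ≤ g (next τ x r)) : rollMean σ f x ≤ rollMean τ g x := by
  unfold rollMean
  gcongr
  exact h _

lemma rollMean_lt {σ τ : Player → Strategy} {f g : Position → ℝ} {x : Position}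
    (h : ∀ r, f (next σ x r) ≤ g (next τ x r)) {r : Face}
    (hr : f (next σ x r) < g (next τ x r)) : rollMean σ f x < rollMean τ g x := by
  refine div_lt_div_of_pos_right ?_ (by norm_num)
  exact Finset.sum_lt_sum (fun r _ => h r) ⟨r, Finset.mem_univ _, hr⟩

lemma abs_rollMean_le (σ : Player → Strategy) (f : Position → ℝ) (x : Position) :
    |rollMean σ f x| ≤ rollMean σ (fun y => |f y|) x := by
  unfold rollMean
  rw [abs_div, abs_of_pos (by norm_num : (0 : ℝ) < 6)]
  gcongr
  exact Finset.abs_sum_le_sum_abs _ _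

/-- Every roll removes a stick from play with probability at least `1 / 6`. -/
lemma rollMean_sticks_le (σ : Player → Strategy) (p : Player) (lid : Finset (Fin 5)) {k l : ℕ}
    (hk : 1 ≤ k) :
    rollMean σ (fun y => (sticks y : ℝ)) (.toRoll p lid k l) ≤
      sticks (.toRoll p lid k l) - 1 / 6 := by
  have h6 : (sticks (next σ (.toRoll p lid k l) none) : ℝ) + 1 ≤ sticks (.toRoll p lid k l) := by
    exact_mod_cast sticks_next_six_lt σ p lid hk
  have h5 : ∑ h : Fin 5, (sticks (next σ (.toRoll p lid k l) (some h)) : ℝ) ≤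
      ∑ _h : Fin 5, (sticks (.toRoll p lid k l) : ℝ) :=
    Finset.sum_le_sum fun h _ => by exact_mod_cast sticks_next_le σ _ _
  simp only [Finset.sum_const, Finset.card_univ, Fintype.card_fin, nsmul_eq_mul] at h5
  simp only [rollMean, Fintype.sum_option]
  push_cast at h5
  linarith

/-- A function that is subharmonic up to an error `ε` grows at most by `ε` times the expected
number of rolls. -/
lemma le_of_le_rollMean_add {N : ℕ} {σ : Player → Strategy} {f : Position → ℝ} {ε : ℝ}
    (hε : 0 ≤ ε) (hwon : ∀ p, f (.won p) ≤ 0)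
    (hf : ∀ p lid k l, Legal N (.toRoll p lid k l) →
      f (.toRoll p lid k l) ≤ rollMean σ f (.toRoll p lid k l) + ε)
    {x : Position} (hx : Legal N x) : f x ≤ 6 * ε * sticks x := by
  -- The mean of `6 * ε * sticks` drops by at least `ε` per roll, which absorbs the error and makes
  -- the difference subharmonic.
  have := nonpos_of_le_rollMean (N := N) (σ := σ) (f := fun y => f y - 6 * ε * sticks y)
    (by simpa [sticks] using hwon) ?_ hx
  · linarith
  · rintro (⟨p, lid, k, l⟩ | p) hy
    · have h1 := hf _ _ _ _ hy
      have h2 := mul_le_mul_of_nonneg_left (rollMean_sticks_le σ p lid (l := l) hy.1) hε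
      have h3 : rollMean σ (fun y => 6 * ε * (sticks y : ℝ)) (.toRoll p lid k l) =
          6 * (ε * rollMean σ (fun y => (sticks y : ℝ)) (.toRoll p lid k l)) := by
        simp only [rollMean, ← Finset.mul_sum]; ring
      rw [rollMean_sub, h3]
      linarith
    · simp [rollMean, next]
      linarith

/-- Two harmonic functions that agree at the end of the game agree everywhere. -/
lemma eq_of_eq_rollMean {N : ℕ} {σ : Player → Strategy} {f g : Position → ℝ}
    (hwon : ∀ p, f (.won p) = g (.won p)) (hf : ∀ x, Legal N x → f x = rollMean σ f x)
    (hg : ∀ x, Legal N x → g x = rollMean σ g x) {x : Position} (hx : Legal N x) : f x = g x := by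
  have h1 := nonpos_of_le_rollMean (σ := σ) (f := fun y => f y - g y)
    (fun p => by simp [hwon]) (fun y hy => by rw [rollMean_sub, ← hf y hy, ← hg y hy]) hx
  have h2 := nonpos_of_le_rollMean (σ := σ) (f := fun y => g y - f y)
    (fun p => by simp [hwon]) (fun y hy => by rw [rollMean_sub, ← hf y hy, ← hg y hy]) hx
  linarith

/-! ### Numerical bounds for the value of `bestStrategy` against itself -/

/-- Winning probabilities of the player about to roll, in millionths, when both players use
`bestStrategy`. The lists are indexed by the number of sticks in play (from two), by the number of
sticks on the lid, and by the number of sticks in the hand of that player (from one). -/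
def millionths : List (List (List ℕ)) :=
  [[[1000000]],
   [[1000000, 861111],
    [833333]],
   [[1000000, 878049, 656730],
    [853659, 615854],
    [715447]],
   [[1000000, 901516, 709085, 453273],
    [881819, 675292, 412582],
    [774903, 464909],
    [612549]],
   [[1000000, 924922, 766809, 540559, 292944],
    [909907, 739867, 506854, 260878],
    [831049, 572689, 288171],
    [713655, 361310],
    [524230]],
   [[1000000, 944300, 818849, 626588, 401040, 189744],
    [933160, 797634, 598543, 373136, 169105],
    [875621, 667560, 419066, 188437],
    [790467, 512325, 236258],
    [658450, 318512],
    [451292]],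
   [[1000000, 958317, 859897, 700649, 501819, 300118, 129673],
    [949980, 843016, 677009, 476865, 279933, 117658],
    [906689, 741266, 530636, 316195, 134212],
    [841902, 623424, 388045, 172264],
    [741303, 480127, 229008],
    [599894, 307032]],
   [[1000000, 968056, 890273, 759608, 588085, 402036, 229995, 94240],
    [961668, 876664, 739550, 565572, 382079, 215970, 87154],
    [928010, 795592, 619008, 426471, 245986, 101316],
    [877007, 701308, 502430, 304350, 132339],
    [797100, 587584, 375911, 177321],
    [686741, 459174, 235768]],
   [[1000000, 974874, 912448, 804883, 658722, 491752, 325584, 180910, 71944],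
    [969848, 901327, 787805, 638545, 472486, 310293, 171092, 67485],
    [942969, 835479, 687611, 518557, 348032, 196365, 79439],
    [901818, 758349, 589808, 412444, 244951, 105006],
    [836699, 664102, 482467, 303395, 141410],
    [747170, 558649, 370053, 188294]],
   [[1000000, 979780, 928852, 839515, 715134, 567800, 412976, 267272, 145584, 56887],
    [975736, 919648, 824928, 697184, 549616, 397221, 255609, 138519, 53875],
    [953827, 865304, 740774, 593571, 437588, 288053, 159950, 63941],
    [920025, 801203, 657682, 500447, 343381, 200877, 85227],
    [866082, 721888, 564917, 403207, 249746, 115220],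
    [791878, 632612, 467561, 305318, 153737]],
   [[1000000, 983423, 941258, 866310, 760064, 630849, 489745, 349306, 222270, 119354, 46115],
    [980108, 933554, 853802, 744174, 613992, 474134, 336572, 213269, 114109, 43961],
    [961964, 888118, 782466, 654404, 513813, 372130, 241316, 132389, 52473],
    [933806, 834211, 711307, 572431, 427847, 289149, 167164, 70370],
    [888558, 766772, 630546, 485075, 340829, 208486, 95406],
    [826262, 690353, 544884, 396618, 255588, 127556]]]

/-- For legal triples with at most 12 sticks, the equations in `approxNext` read the default 0 only
in terms whose factor `j` or `5 - j` vanishes. -/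
def approx (j k l : ℕ) : ℕ :=
  ((millionths.getD (j + k + l - 2) []).getD j []).getD (k - 1) 0

/-- Whether `bestStrategy` continues at `(j, k, l)`. -/
def continues (j k l : ℕ) : Bool :=
  j ≤ 3 || (j == 4 && k == 1 && l == 1)

/-- The approximate value, for the player who has just placed a stick, of what results. -/
def approxAfter (j k l : ℕ) : ℕ :=
  if k = 0 then 1000000 else if continues j k l then approx j k l else 1000000 - approx j l k

/-- Six times the approximate value after the next roll. -/
def approxNext (j k l : ℕ) : ℕ :=
  approxAfter j (k - 1) l + j * (1000000 - approx (j - 1) l (k + 1)) +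
    (5 - j) * approxAfter (j + 1) (k - 1) l

/-- The table satisfies the equations of the winning probabilities up to one millionth. -/
lemma approx_residual : ∀ j < 6, ∀ k < 12, ∀ l < 12, 1 ≤ k ∧ 1 ≤ l ∧ j + k + l ≤ 12 →
    6 * approx j k l ≤ approxNext j k l + 6 ∧ approxNext j k l ≤ 6 * approx j k l + 6 := by
  decide +kernel

lemma approx_le_million : ∀ j < 6, ∀ k < 12, ∀ l < 12, 1 ≤ k ∧ 1 ≤ l ∧ j + k + l ≤ 12 →
    approx j k l ≤ 1000000 := by
  decide +kernel

/-- Continuing is better precisely where `bestStrategy` continues, by more than the error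
of the table. -/
lemma approx_gap : ∀ j < 6, ∀ k < 12, ∀ l < 12, 1 ≤ j ∧ 1 ≤ k ∧ 1 ≤ l ∧ j + k + l ≤ 12 →
    if continues j k l then 1000000 + 12 * (j + k + l) < approx j k l + approx j l k
    else approx j k l + approx j l k + 12 * (j + k + l) < 1000000 := by
  decide +kernel

lemma bestStrategy_eq (j k l : ℕ) :
    bestStrategy (j, k, l) = if continues j k l then .rollAgain else .passDie := by
  simp [bestStrategy, continues, and_assoc]

/-- Both players use `bestStrategy`. -/
def best : Player → Strategy := fun _ => bestStrategy

/-- The table as an approximation to the probability that player one wins. -/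
def approxValue : Position → ℝ
  | .won .one => 1
  | .won .two => 0
  | .toRoll .one lid k l => approx lid.card k l / 1000000
  | .toRoll .two lid k l => 1 - approx lid.card k l / 1000000

/-- The value for player one of a position that is worth `v` to player `p`. -/
def fromView : Player → ℝ → ℝ
  | .one, v => v
  | .two, v => 1 - v

lemma card_lid_le (lid : Finset (Fin 5)) : lid.card ≤ 5 := by
  simpa using lid.card_le_univ

lemma approx_le {j k l : ℕ} (hj : j ≤ 5) (hk : 1 ≤ k) (hl : 1 ≤ l) (h : j + k + l ≤ 12) :
    approx j k l ≤ 1000000 :=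
  approx_le_million j (by omega) k (by omega) l (by omega) ⟨hk, hl, h⟩

lemma approxValue_toRoll (p : Player) (lid : Finset (Fin 5)) (k l : ℕ) :
    approxValue (.toRoll p lid k l) = fromView p (approx lid.card k l / 1000000) := by
  cases p <;> rfl

lemma approxValue_toRoll_other (p : Player) (lid : Finset (Fin 5)) {k l : ℕ} (hk : 1 ≤ k)
    (hl : 1 ≤ l) (h : lid.card + k + l ≤ 12) :
    approxValue (.toRoll p.other lid k l) =
      fromView p (((1000000 - approx lid.card k l : ℕ) : ℝ) / 1000000) := by
  have := approx_le (card_lid_le lid) hk hl h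
  cases p <;> simp [approxValue, fromView, Player.other, Nat.cast_sub this] <;> ring

lemma approxValue_afterPlacing (p : Player) (lid : Finset (Fin 5)) {k l : ℕ} (hl : 1 ≤ l)
    (h : lid.card + k + l ≤ 12) :
    approxValue (afterPlacing best p lid k l) =
      fromView p (approxAfter lid.card k l / 1000000) := by
  unfold afterPlacing approxAfter
  by_cases hk : k = 0
  · cases p <;> simp [hk, approxValue, fromView]
  · simp only [hk, if_false]
    by_cases hc : continues lid.card k l = true
    · rw [if_pos (Or.inr (by simp [best, bestStrategy_eq, hc])), if_pos hc, approxValue_toRoll]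
    · have hne : lid ≠ ∅ := by
        rintro rfl; simp [continues] at hc
      rw [if_neg (by simp [best, bestStrategy_eq, hc, hne]), if_neg hc,
        approxValue_toRoll_other _ _ hl (by omega) (by omega)]

/-- The faces fall into three classes: the six, the occupied holes and the free holes. It suffices
that `f` is constant on each class of outcomes. -/
lemma rollMean_toRoll (σ : Player → Strategy) (f : Position → ℝ) (p : Player)
    (lid : Finset (Fin 5)) (k l : ℕ) {a b c : ℝ}
    (ha : f (afterPlacing σ p lid (k - 1) l) = a)
    (hb : ∀ h ∈ lid, f (.toRoll p.other (lid.erase h) l (k + 1)) = b)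
    (hc : ∀ h ∉ lid, f (afterPlacing σ p (insert h lid) (k - 1) l) = c) :
    rollMean σ f (.toRoll p lid k l) = (a + lid.card * b + (5 - lid.card : ℕ) * c) / 6 := by
  have h5 : ∀ h : Fin 5, f (next σ (.toRoll p lid k l) (some h)) = if h ∈ lid then b else c := by
    intro h
    by_cases hh : h ∈ lid
    · simp [next, hh, hb]
    · simp [next, hh, hc]
  have hcompl : (Finset.univ.filter fun h => h ∉ lid).card = 5 - lid.card := by
    rw [← Finset.compl_filter, Finset.card_compl]; simp
  have h6 : f (next σ (.toRoll p lid k l) none) = a := ha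
  rw [rollMean, Fintype.sum_option, h6, Finset.sum_congr rfl fun h _ => h5 h, Finset.sum_ite]
  simp only [Finset.sum_const, hcompl, nsmul_eq_mul]
  simp [add_assoc]

lemma abs_approxValue_sub_rollMean_le (p : Player) (lid : Finset (Fin 5)) (k l : ℕ)
    (h : Legal 12 (.toRoll p lid k l)) :
    |approxValue (.toRoll p lid k l) - rollMean best approxValue (.toRoll p lid k l)| ≤
      1 / 1000000 := by
  obtain ⟨hk, hl, h⟩ := h
  have h5 := card_lid_le lid
  obtain ⟨h1, h2⟩ := approx_residual lid.card (by omega) k (by omega) l (by omega) ⟨hk, hl, h⟩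
  have key : rollMean best approxValue (.toRoll p lid k l) =
      fromView p (approxNext lid.card k l / 6000000) := by
    rw [rollMean_toRoll best approxValue p lid k l
      (approxValue_afterPlacing p lid hl (by omega))
      (b := fromView p (((1000000 - approx (lid.card - 1) l (k + 1) : ℕ) : ℝ) / 1000000))
      (c := fromView p (approxAfter (lid.card + 1) (k - 1) l / 1000000))]
    · have hs : ((5 - lid.card : ℕ) : ℝ) = 5 - lid.card := by push_cast [h5]; ring
      unfold approxNext
      cases p <;> simp only [fromView, Nat.cast_add, Nat.cast_mul, hs] <;> ring
    · intro h hh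
      have hcard := Finset.card_erase_add_one hh
      rw [approxValue_toRoll_other _ _ hl (by omega) (by omega), Finset.card_erase_of_mem hh]
    · intro h hh
      have hcard := Finset.card_insert_of_notMem hh
      rw [approxValue_afterPlacing _ _ hl (by omega), hcard]
  have h1' : (6 * approx lid.card k l : ℝ) ≤ approxNext lid.card k l + 6 := by exact_mod_cast h1
  have h2' : (approxNext lid.card k l : ℝ) ≤ 6 * approx lid.card k l + 6 := by exact_mod_cast h2
  rw [key, approxValue_toRoll, abs_le]
  cases p <;> simp only [fromView] <;> constructor <;> linarith

lemma abs_value_sub_approxValue_le {x : Position} (hx : Legal 12 x) :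
    |value best x - approxValue x| ≤ 6 / 1000000 * sticks x := by
  have hv := value_eq_rollMean best
  have hwon : ∀ p, value best (.won p) = approxValue (.won p) := by
    rintro (_ | _) <;> simp [approxValue]
  have h1 := le_of_le_rollMean_add (σ := best) (f := fun y => value best y - approxValue y)
    (ε := 1 / 1000000) (by norm_num) (fun p => by simp [hwon]) (fun p lid k l hy => by
      have := (abs_le.1 (abs_approxValue_sub_rollMean_le p lid k l hy)).1
      rw [rollMean_sub, ← hv]; linarith) hx
  have h2 := le_of_le_rollMean_add (σ := best) (f := fun y => approxValue y - value best y)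
    (ε := 1 / 1000000) (by norm_num) (fun p => by simp [hwon]) (fun p lid k l hy => by
      have := (abs_le.1 (abs_approxValue_sub_rollMean_le p lid k l hy)).2
      rw [rollMean_sub, ← hv]; linarith) hx
  rw [abs_le]
  constructor <;> linarith

/-- The advantage of continuing over stopping at a nonempty lid. -/
lemma value_gap (lid : Finset (Fin 5)) {k l : ℕ} (hlid : lid ≠ ∅) (hk : 1 ≤ k)
    (hl : 1 ≤ l) (h : lid.card + k + l ≤ 12) :
    if continues lid.card k l then
      value best (.toRoll .two lid l k) < value best (.toRoll .one lid k l) ∧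
      value best (.toRoll .two lid k l) < value best (.toRoll .one lid l k)
    else
      value best (.toRoll .one lid k l) < value best (.toRoll .two lid l k) ∧
      value best (.toRoll .one lid l k) < value best (.toRoll .two lid k l) := by
  have h5 := card_lid_le lid
  have hpos : 1 ≤ lid.card := Finset.card_pos.2 (Finset.nonempty_iff_ne_empty.2 hlid)
  have hgap := approx_gap lid.card (by omega) k (by omega) l (by omega)
    -- The margin of 12 millionths per stick covers two table values, each off by at most 6
    -- millionths per stick.
    ⟨hpos, hk, hl, h⟩
  have h1 := abs_le.1 (abs_value_sub_approxValue_le (x := .toRoll .one lid k l) ⟨hk, hl, h⟩)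
  have h2 := abs_le.1 (abs_value_sub_approxValue_le (x := .toRoll .two lid k l) ⟨hk, hl, h⟩)
  have h3 := abs_le.1 (abs_value_sub_approxValue_le (x := .toRoll .one lid l k)
    ⟨hl, hk, by omega⟩)
  have h4 := abs_le.1 (abs_value_sub_approxValue_le (x := .toRoll .two lid l k)
    ⟨hl, hk, by omega⟩)
  simp only [approxValue, sticks, Nat.cast_add] at h1 h2 h3 h4
  split_ifs with hc
  · rw [if_pos hc] at hgap
    have hgap' : (1000000 + 12 * (lid.card + k + l) : ℝ) <
        approx lid.card k l + approx lid.card l k := by exact_mod_cast hgap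
    constructor <;> linarith
  · rw [if_neg hc] at hgap
    have hgap' : (approx lid.card k l + approx lid.card l k + 12 * (lid.card + k + l) : ℝ) <
        1000000 := by exact_mod_cast hgap
    constructor <;> linarith

/-! ### Deviations from `bestStrategy` -/

lemma afterPlacing_congr {σ τ : Player → Strategy} {p : Player} {lid : Finset (Fin 5)} {k l : ℕ}
    (h : k ≠ 0 → lid ≠ ∅ → σ p (lid.card, k, l) = τ p (lid.card, k, l)) :
    afterPlacing σ p lid k l = afterPlacing τ p lid k l := by
  unfold afterPlacing
  by_cases hk : k = 0
  · simp [hk]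
  · by_cases hlid : lid = ∅
    · simp [hlid]
    · rw [h hk hlid]

lemma afterPlacing_of_rollAgain {σ : Player → Strategy} {p : Player} {lid : Finset (Fin 5)}
    {k l : ℕ} (hk : k ≠ 0) (h : lid = ∅ ∨ σ p (lid.card, k, l) = .rollAgain) :
    afterPlacing σ p lid k l = .toRoll p lid k l := by
  rw [afterPlacing, if_neg hk, if_pos h]

lemma afterPlacing_of_ne_rollAgain {σ : Player → Strategy} {p : Player} {lid : Finset (Fin 5)}
    {k l : ℕ} (hk : k ≠ 0) (hlid : lid ≠ ∅) (h : σ p (lid.card, k, l) ≠ .rollAgain) :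
    afterPlacing σ p lid k l = .toRoll p.other lid l k := by
  rw [afterPlacing, if_neg hk, if_neg (by simp [hlid, h])]

/-- A player whose choice differs from that of `bestStrategy` is strictly worse off. -/
lemma fromView_value_afterPlacing_lt (σ : Player → Strategy) (p : Player) {lid : Finset (Fin 5)}
    {k l : ℕ} (hlid : lid ≠ ∅) (hk : 1 ≤ k) (hl : 1 ≤ l) (h : lid.card + k + l ≤ 12)
    (hσ : σ p (lid.card, k, l) ≠ bestStrategy (lid.card, k, l)) :
    fromView p (value best (afterPlacing σ p lid k l)) <
      fromView p (value best (afterPlacing best p lid k l)) := by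
  have hgap := value_gap lid hlid hk hl h
  have hk0 : k ≠ 0 := by omega
  rw [bestStrategy_eq] at hσ
  by_cases hc : continues lid.card k l = true
  · rw [if_pos hc] at hgap hσ
    rw [afterPlacing_of_ne_rollAgain hk0 hlid hσ,
      afterPlacing_of_rollAgain (σ := best) hk0 (Or.inr (by simp [best, bestStrategy_eq, hc]))]
    cases p <;> simp only [fromView, Player.other] <;> linarith [hgap.1, hgap.2]
  · rw [if_neg hc] at hgap hσ
    have hroll : σ p (lid.card, k, l) = .rollAgain := by
      cases hs : σ p (lid.card, k, l) with
      | passDie => exact absurd hs hσ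
      | rollAgain => rfl
    rw [afterPlacing_of_rollAgain hk0 (Or.inr hroll),
      afterPlacing_of_ne_rollAgain (σ := best) hk0 hlid (by simp [best, bestStrategy_eq, hc])]
    cases p <;> simp only [fromView, Player.other] <;> linarith [hgap.1, hgap.2]

lemma fromView_value_afterPlacing_le (σ : Player → Strategy) (p : Player) (lid : Finset (Fin 5))
    {k l : ℕ} (hl : 1 ≤ l) (h : lid.card + k + l ≤ 12) :
    fromView p (value best (afterPlacing σ p lid k l)) ≤
      fromView p (value best (afterPlacing best p lid k l)) := by
  by_cases hc : k ≠ 0 ∧ lid ≠ ∅ ∧ σ p (lid.card, k, l) ≠ bestStrategy (lid.card, k, l)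
  · exact (fromView_value_afterPlacing_lt σ p hc.2.1 (by omega) hl h hc.2.2).le
  · rw [afterPlacing_congr (τ := best)]
    intro hk hlid
    by_contra hne
    exact hc ⟨hk, hlid, hne⟩

lemma fromView_value_next_le (σ : Player → Strategy) (p : Player) (lid : Finset (Fin 5))
    {k l : ℕ} (h : Legal 12 (.toRoll p lid k l)) (r : Face) :
    fromView p (value best (next σ (.toRoll p lid k l) r)) ≤
      fromView p (value best (next best (.toRoll p lid k l) r)) := by
  obtain ⟨hk, hl, h⟩ := h
  rcases r with _ | r
  · exact fromView_value_afterPlacing_le σ p lid hl (by omega)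
  · by_cases hr : r ∈ lid
    · simp [next, hr]
    · have := Finset.card_insert_of_notMem hr
      simpa [next, hr] using fromView_value_afterPlacing_le σ p (insert r lid) hl (by omega)

/-- `bestStrategy` is a best response of player one to itself. -/
lemma value_le_value_best {σ : Player → Strategy} (hσ : σ .two = bestStrategy) {x : Position}
    (hx : Legal 12 x) : value σ x ≤ value best x := by
  have := nonpos_of_le_rollMean (σ := σ) (f := fun y => value σ y - value best y)
    (by rintro (_ | _) <;> simp) ?_ hx
  · linarith
  · intro y hy
    rw [rollMean_sub, ← value_eq_rollMean σ y]
    -- One-shot deviation principle: if no single choice of `σ` improves on `best`, then `value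
    -- best` is superharmonic for `σ` and dominates `value σ`.
    suffices rollMean σ (value best) y ≤ value best y by linarith
    rw [value_eq_rollMean best y]
    refine rollMean_mono fun r => ?_
    rcases y with ⟨_ | _, lid, k, l⟩ | p
    · exact fromView_value_next_le σ .one lid hy r
    · have hn : next σ (.toRoll .two lid k l) r = next best (.toRoll .two lid k l) r := by
        rcases r with _ | r <;> simp only [next]
        · exact afterPlacing_congr fun _ _ => by rw [hσ, best]
        · split_ifs
          · rfl
          · exact afterPlacing_congr fun _ _ => by rw [hσ, best]
      rw [hn]
    · exact le_rfl

/-- `bestStrategy` guarantees player one the value of `bestStrategy` against itself. -/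
lemma value_best_le_value {σ : Player → Strategy} (hσ : σ .one = bestStrategy) {x : Position}
    (hx : Legal 12 x) : value best x ≤ value σ x := by
  have := nonpos_of_le_rollMean (σ := σ) (f := fun y => value best y - value σ y)
    (by rintro (_ | _) <;> simp) ?_ hx
  · linarith
  · intro y hy
    rw [rollMean_sub, ← value_eq_rollMean σ y]
    suffices value best y ≤ rollMean σ (value best) y by linarith
    rw [value_eq_rollMean best y]
    refine rollMean_mono fun r => ?_
    rcases y with ⟨_ | _, lid, k, l⟩ | p
    · have hn : next σ (.toRoll .one lid k l) r = next best (.toRoll .one lid k l) r := by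
        rcases r with _ | r <;> simp only [next]
        · exact afterPlacing_congr fun _ _ => by rw [hσ, best]
        · split_ifs
          · rfl
          · exact afterPlacing_congr fun _ _ => by rw [hσ, best]
      rw [hn]
    · have := fromView_value_next_le σ .two lid hy r
      simp only [fromView] at this
      linarith
    · exact le_rfl

/-- A wrong choice at `(j, k, l)` lowers the expected value of the roll from which that choice is
reached. -/
lemma rollMean_value_best_lt (σ : Player → Strategy) {lid : Finset (Fin 5)} {j k l : ℕ}
    (hj : lid.card + 1 = j) (hj5 : j ≤ 5) (hk : 1 ≤ k) (hl : 1 ≤ l) (h : j + k + l ≤ 12)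
    (hσ : σ .one (j, k, l) ≠ bestStrategy (j, k, l)) :
    rollMean σ (value best) (.toRoll .one lid (k + 1) l) <
      value best (.toRoll .one lid (k + 1) l) := by
  rw [value_eq_rollMean best]
  -- As `j ≤ 5`, the lid has a free hole; rolling it leads to the wrong choice.
  obtain ⟨r, hr⟩ : ∃ r, r ∉ lid := by
    by_contra! hall
    have : lid = Finset.univ := Finset.eq_univ_iff_forall.2 hall
    simp [this] at hj
    omega
  have hcard := Finset.card_insert_of_notMem hr
  refine rollMean_lt (r := some r)
    (fromView_value_next_le σ .one lid ⟨by omega, hl, by omega⟩) ?_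
  have := fromView_value_afterPlacing_lt σ .one (lid := insert r lid) (k := k) (l := l)
    (Finset.insert_ne_empty _ _) hk hl (by omega) (by rwa [hcard, hj])
  simpa [next, hr, fromView] using this

/-! ### Symmetries -/

/-- The position with the players interchanged. -/
def swapPlayers : Position → Position
  | .toRoll p lid k l => .toRoll p.other lid k l
  | .won p => .won p.other

/-- The position with the shallow holes relabelled. -/
def relabel (e : Equiv.Perm (Fin 5)) : Position → Position
  | .toRoll p lid k l => .toRoll p (lid.map e.toEmbedding) k l
  | .won p => .won p

lemma next_swapPlayers (S : Strategy) (x : Position) (r : Face) :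
    next (fun _ => S) (swapPlayers x) r = swapPlayers (next (fun _ => S) x r) := by
  rcases x with ⟨p, lid, k, l⟩ | p
  · rcases r with _ | r
    · simp only [next, swapPlayers, afterPlacing]
      split_ifs <;> rfl
    · simp only [next, swapPlayers, afterPlacing]
      split_ifs <;> rfl
  · rfl

lemma next_relabel (σ : Player → Strategy) (e : Equiv.Perm (Fin 5)) (x : Position) (r : Face) :
    next σ (relabel e x) (r.map e) = relabel e (next σ x r) := by
  have hafter : ∀ p lid k l, afterPlacing σ p (lid.map e.toEmbedding) k l =
      relabel e (afterPlacing σ p lid k l) := by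
    intro p lid k l
    by_cases hk : k = 0
    · simp [afterPlacing, hk, relabel]
    · by_cases h : lid = ∅ ∨ σ p (lid.card, k, l) = .rollAgain
      · rw [afterPlacing_of_rollAgain hk h, afterPlacing_of_rollAgain hk (by simpa using h)]
        rfl
      · rw [not_or] at h
        rw [afterPlacing_of_ne_rollAgain hk h.1 h.2,
          afterPlacing_of_ne_rollAgain hk (by simpa using h.1) (by simpa using h.2)]
        rfl
  rcases x with ⟨p, lid, k, l⟩ | p
  · rcases r with _ | r
    · exact hafter _ _ _ _
    · by_cases hr : r ∈ lid
      · simp [next, relabel, hr, Finset.map_erase]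
      · have := hafter p (insert r lid) (k - 1) l
        rw [Finset.map_insert] at this
        simpa [next, hr, relabel] using this
  · rfl

/-- When both players use the same strategy, exactly one of them wins. -/
lemma value_swapPlayers (S : Strategy) {N : ℕ} {x : Position} (hx : Legal N x) :
    value (fun _ => S) (swapPlayers x) = 1 - value (fun _ => S) x := by
  refine eq_of_eq_rollMean (σ := fun _ => S)
    (f := fun x => value (fun _ => S) (swapPlayers x)) (g := fun x => 1 - value (fun _ => S) x)
    ?_ ?_ ?_ hx
  · rintro (_ | _) <;> simp [swapPlayers, Player.other]
  · intro y _
    rw [value_eq_rollMean]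
    simp only [rollMean, next_swapPlayers]
  · intro y _
    rw [value_eq_rollMean, rollMean_sub]
    simp [rollMean]

lemma value_relabel (σ : Player → Strategy) (e : Equiv.Perm (Fin 5)) {N : ℕ} {x : Position}
    (hx : Legal N x) : value σ (relabel e x) = value σ x := by
  refine eq_of_eq_rollMean (σ := σ) (f := fun x => value σ (relabel e x)) ?_ ?_
    (fun y _ => value_eq_rollMean σ y) hx
  · exact fun _ => rfl
  · intro y _
    rw [value_eq_rollMean]
    simp only [rollMean, ← next_relabel]
    rw [← Equiv.sum_comp (Equiv.optionCongr e)]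
    rfl

/-- The winning probability depends on the lid only through the number of sticks on it. -/
lemma value_eq_of_card_eq (σ : Player → Strategy) (p : Player) {lid lid' : Finset (Fin 5)}
    {k l : ℕ} (hk : 1 ≤ k) (hl : 1 ≤ l) (h : lid.card = lid'.card) :
    value σ (.toRoll p lid k l) = value σ (.toRoll p lid' k l) := by
  -- A bijection between the two lids extends to a permutation of the holes, and the game is
  -- invariant under relabelling.
  let e : {a // a ∈ lid} ≃ {a // a ∈ lid'} := Finset.equivOfCardEq h
  have hmap : lid.map e.extendSubtype.toEmbedding = lid' := by
    refine Finset.eq_of_subset_of_card_le ?_ (by simp [h])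
    intro b hb
    obtain ⟨a, ha, rfl⟩ := Finset.mem_map.1 hb
    exact e.extendSubtype_mem a ha
  have := value_relabel σ e.extendSubtype (x := .toRoll p lid k l) ⟨hk, hl, le_rfl⟩
  rw [← this, relabel, hmap]

/-! ### Changing a single choice of both players -/

/-- With at most `j + k + l` sticks in play the altered choice cannot follow a six, which would
leave too few sticks. It is reached only by filling a hole from `(j - 1, k + 1, l)`. -/
lemma next_update_eq {j k l : ℕ} {c : Choice} {p : Player} {lid : Finset (Fin 5)} {k' l' : ℕ}
    (hk' : 1 ≤ k') (h : lid.card + k' + l' ≤ j + k + l)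
    (hne : ¬ (lid.card + 1 = j ∧ k' = k + 1 ∧ l' = l)) (r : Face) :
    next (fun _ => Function.update bestStrategy (j, k, l) c) (.toRoll p lid k' l') r =
      next best (.toRoll p lid k' l') r := by
  rcases r with _ | r <;> simp only [next]
  · refine afterPlacing_congr fun _ _ => ?_
    rw [Function.update_of_ne]
    · rfl
    · simp only [ne_eq, Prod.mk.injEq]; omega
  · split_ifs with hr
    · rfl
    · refine afterPlacing_congr fun _ _ => ?_
      rw [Function.update_of_ne]
      · rfl
      · have := Finset.card_insert_of_notMem hr
        simp only [ne_eq, Prod.mk.injEq]; omega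

/-- Suppose the change `D` in value is nonnegative where player one faces the altered choice. There
`D` is strictly below its mean, so `|D|` is at most the mean of `|D|`; antisymmetry gives the same
for player two, and elsewhere `D` is harmonic. The maximum principle forces `D = 0`, against the
strict inequality. -/
lemma value_update_lt {lid : Finset (Fin 5)} {j k l : ℕ} {c : Choice}
    (hj : lid.card + 1 = j) (hj5 : j ≤ 5) (hk : 1 ≤ k) (hl : 1 ≤ l) (h : j + k + l ≤ 12)
    (hc : c ≠ bestStrategy (j, k, l)) :
    value (fun _ => Function.update bestStrategy (j, k, l) c) (.toRoll .one lid (k + 1) l) <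
      value best (.toRoll .one lid (k + 1) l) := by
  set S := Function.update bestStrategy (j, k, l) c with hS
  set σ : Player → Strategy := fun _ => S with hσ
  by_contra! hle
  let D : Position → ℝ := fun x => value σ x - value best x
  have hmean : ∀ x, rollMean σ D x = value σ x - rollMean σ (value best) x := fun x => by
    rw [rollMean_sub, ← value_eq_rollMean]
  have hswap : ∀ x, Legal (j + k + l) x → D (swapPlayers x) = -D x := fun x hx => by
    simp only [D]
    have hb : value best (swapPlayers x) = 1 - value best x := value_swapPlayers bestStrategy hx
    rw [hσ, value_swapPlayers S hx, hb]
    ring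
  have hlt : ∀ lid' : Finset (Fin 5), lid'.card + 1 = j →
      D (.toRoll .one lid' (k + 1) l) < rollMean σ D (.toRoll .one lid' (k + 1) l) := by
    intro lid' hj'
    have := rollMean_value_best_lt σ hj' hj5 hk hl h (by simpa [hσ, hS] using hc)
    rw [hmean]
    simp only [D]
    linarith
  have hnonneg : ∀ lid' : Finset (Fin 5), lid'.card + 1 = j →
      0 ≤ D (.toRoll .one lid' (k + 1) l) := by
    intro lid' hj'
    simp only [D]
    -- The assumption concerns one lid; relabelling holes carries it to every lid of the same size.
    rw [value_eq_of_card_eq σ .one (by omega) hl (by omega : lid'.card = lid.card),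
      value_eq_of_card_eq best .one (by omega) hl (by omega : lid'.card = lid.card)]
    linarith
  have hrollswap : ∀ x, Legal (j + k + l) x → rollMean σ D (swapPlayers x) = -rollMean σ D x := by
    intro x hx
    simp only [rollMean, hσ, next_swapPlayers]
    rw [Finset.sum_congr rfl fun r _ => hswap _ (next_legal (fun _ => S) hx r),
      Finset.sum_neg_distrib, neg_div]
  have habs : ∀ x, Legal (j + k + l) x → |D x| ≤ rollMean σ (fun y => |D y|) x := by
    intro x hx
    refine le_trans ?_ (abs_rollMean_le σ D x)
    rcases x with ⟨p, lid', k', l'⟩ | p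
    · by_cases hA : lid'.card + 1 = j ∧ k' = k + 1 ∧ l' = l
      · obtain ⟨hj', rfl, rfl⟩ := hA
        have h0 := hnonneg lid' hj'
        have h1 := (hlt lid' hj').le
        have hone : |D (.toRoll .one lid' (k + 1) l')| ≤
            |rollMean σ D (.toRoll .one lid' (k + 1) l')| := abs_le_abs_of_nonneg h0 h1
        cases p with
        | one => exact hone
        | two =>
          have hx1 : Legal (j + k + l') (.toRoll .one lid' (k + 1) l') := hx
          have e1 := hswap _ hx1
          have e2 := hrollswap _ hx1
          simp only [swapPlayers, Player.other] at e1 e2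
          rwa [e1, e2, abs_neg, abs_neg]
      · have hn : rollMean σ (value best) (.toRoll p lid' k' l') =
            value best (.toRoll p lid' k' l') := by
          rw [value_eq_rollMean best (.toRoll p lid' k' l')]
          simp only [rollMean, hσ, hS, next_update_eq hx.1 hx.2.2 hA]
        rw [hmean, hn]
    · cases p <;> simp [D]
  have hzero : ∀ x, Legal (j + k + l) x → D x = 0 := fun x hx =>
    abs_nonpos_iff.1 (nonpos_of_le_rollMean (σ := σ) (f := fun y => |D y|)
      (by rintro (_ | _) <;> simp [D]) habs hx)
  have hx : Legal (j + k + l) (.toRoll .one lid (k + 1) l) := ⟨by omega, hl, by omega⟩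
  have := hlt lid hj
  rw [hzero _ hx, rollMean, Finset.sum_congr rfl fun r _ => hzero _ (next_legal σ hx r)] at this
  simp at this

/-! ### Winning probabilities -/

/-- Player one uses `S`, player two uses `T`. -/
def profile (S T : Strategy) : Player → Strategy
  | .one => S
  | .two => T

lemma profile_self (S : Strategy) : profile S S = fun _ => S := by
  funext p; cases p <;> rfl

lemma toReal_winProb (S T : Strategy) (lid : Finset (Fin 5)) (k l : ℕ) :
    (winProb S T lid k l).toReal = value (profile S T) (.toRoll .one lid k l) := by
  unfold winProb value
  congr! 4

lemma winProb_ne_top (S T : Strategy) (lid : Finset (Fin 5)) (k l : ℕ) :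
    winProb S T lid k l ≠ ⊤ :=
  iSup_play_ne_top _ _ _

lemma winProb_le_iff (S T S' T' : Strategy) (lid : Finset (Fin 5)) (k l : ℕ) :
    winProb S T lid k l ≤ winProb S' T' lid k l ↔
      value (profile S T) (.toRoll .one lid k l) ≤ value (profile S' T') (.toRoll .one lid k l) := by
  rw [← toReal_winProb, ← toReal_winProb,
    ENNReal.toReal_le_toReal (winProb_ne_top _ _ _ _ _) (winProb_ne_top _ _ _ _ _)]

/-! ### Optimality and uniqueness -/

theorem isOptimal_bestStrategy {i : ℕ} (hi : i ≤ 12) : IsOptimal i bestStrategy := by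
  intro lid k l hk hl h T
  have hx : Legal 12 (.toRoll .one lid k l) := ⟨hk, hl, by omega⟩
  rw [winProb_le_iff, winProb_le_iff, profile_self]
  exact ⟨value_le_value_best rfl hx, value_best_le_value rfl hx⟩

theorem IsOptimal.eq_bestStrategy {i : ℕ} (hi : i ≤ 12) {S : Strategy} (hS : IsOptimal i S)
    {j k l : ℕ} (hj : 1 ≤ j) (hj5 : j ≤ 5) (hk : 1 ≤ k) (hl : 1 ≤ l) (h : j + k + l = i) :
    S (j, k, l) = bestStrategy (j, k, l) := by
  by_contra hne
  obtain ⟨lid, -, hlid⟩ := Finset.exists_subset_card_eq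
    (s := (Finset.univ : Finset (Fin 5))) (n := j - 1) (by simp; omega)
  have hopt := hS lid (k + 1) l (by omega) hl (by omega) bestStrategy
  have hbest := (isOptimal_bestStrategy hi lid (k + 1) l (by omega) hl (by omega) S).2
  -- Interchanging equilibria: `S` against `bestStrategy` earns at least what `bestStrategy` earns
  -- against itself. The wrong choice, one roll away, makes it earn strictly less.
  have hle := (hbest.trans hopt.1).trans hopt.2
  rw [winProb_le_iff, profile_self] at hle
  have hx : Legal 12 (.toRoll .one lid (k + 1) l) := ⟨by omega, hl, by omega⟩
  have hlt := rollMean_value_best_lt (profile S bestStrategy) (lid := lid) (by omega : _ = j)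
    hj5 hk hl (by omega) hne
  have hmono : rollMean (profile S bestStrategy) (value (profile S bestStrategy))
      (.toRoll .one lid (k + 1) l) ≤
      rollMean (profile S bestStrategy) (value best) (.toRoll .one lid (k + 1) l) :=
    rollMean_mono fun r => value_le_value_best rfl (next_legal _ hx r)
  rw [← value_eq_rollMean] at hmono
  exact absurd hlt (hle.trans hmono).not_gt

end SuperSix

end

theorem mainTheorem5 (i : ℕ) (h8 : 8 ≤ i) (h12 : i ≤ 12) :
    -- an optimal strategy
    SuperSix.IsOptimal i SuperSix.bestStrategy ∧
    -- every optimal strategy makes the stated choices with `i` sticks in play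
    (∀ S : SuperSix.Strategy, SuperSix.IsOptimal i S →
      ∀ j k l : ℕ, 1 ≤ j → j ≤ 5 → 1 ≤ k → 1 ≤ l → j + k + l = i →
        (j ≤ 3 → S (j, k, l) = .rollAgain) ∧ (4 ≤ j → S (j, k, l) = .passDie)) ∧
    -- when both players use the same strategy, changing its choice at `(j, k, l)` strictly lowers
    -- the winning probability at `(j - 1, k + 1, l)`, from where the choice is reached
    (∀ j k l : ℕ, 1 ≤ j → j ≤ 5 → 1 ≤ k → 1 ≤ l → j + k + l = i →
      ∀ c : SuperSix.Choice, c ≠ SuperSix.bestStrategy (j, k, l) →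
      ∀ S : SuperSix.Strategy, S = Function.update SuperSix.bestStrategy (j, k, l) c →
      ∀ lid : Finset (Fin 5), lid.card + 1 = j →
        SuperSix.winProb S S lid (k + 1) l <
          SuperSix.winProb SuperSix.bestStrategy SuperSix.bestStrategy lid (k + 1) l) := by
  refine ⟨SuperSix.isOptimal_bestStrategy h12, ?_, ?_⟩
  · intro S hS j k l hj hj5 hk hl h
    rw [hS.eq_bestStrategy h12 hj hj5 hk hl h]
    -- The exception `(4, 1, 1)` has six sticks in play, fewer than `i`.
    refine ⟨fun h3 => if_pos (Or.inl h3), fun h4 => if_neg ?_⟩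
    simp only [Prod.mk.injEq]
    omega
  · rintro j k l hj hj5 hk hl h c hc S rfl lid hlid
    rw [← not_le, SuperSix.winProb_le_iff, not_le, SuperSix.profile_self, SuperSix.profile_self]
    exact SuperSix.value_update_lt hlid hj5 hk hl (by omega) hc
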